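/- Let $\mathcal F$ be an ordinary differential field of characteristic $0$ with derivation $\delta$, let $\mathcal E$ be a universal differential extension field of $\mathcal F$ (that is, for every finitely generated differential extension field $K\subseteq\mathcal E$ of $\mathcal F$, every finitely generated differential extension field of $K$ embeds into $\mathcal E$ over $K$), and let $\mathcal F\{x,y\}=\mathcal F[x^{(k)},y^{(k)}:k\in\mathbb N]$ be the ring of differential polynomials in two differential indeterminates. For $\Sigma\subset\mathcal F\{x,y\}$ let $[\Sigma]$ be the differential ideal generated by $\Sigma$, and let $\operatorname{ord}(f)$ be the largest $k$ such that $x^{(k)}$ or $y^{(k)}$ appears in $f$. Fix any ranking on the derivatives $x^{(k)},y^{(k)}$. For $A\in\mathcal F\{x,y\}\setminus\mathcal F$ irreducible, let $\operatorname{sat}(A)=\{f\in\mathcal F\{x,y\}:(S_AI_A)^m f\in[A]\text{ for some }m\in\mathbb N\}$, where $S_A$ and $I_A$ are the separant and the initial of $A$, and let $\mathcal C=\mathbb V(\operatorname{sat}(A))\subseteq\mathbb A^2(\mathcal E)$ be the differential curve defined by $A$, denoted $(\mathcal C,A)$. We say that $(\mathcal C,A)$ (or $A$) is unirational if there are $u\in\mathcal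 E$ differentially transcendental over $\mathcal F$ and $P_1,Q_1,P_2,Q_2\in\mathcal F\{u\}$ with $Q_i\neq0$ and $\gcd(P_i,Q_i)=1$ for $i=1,2$ such that $\big(P_1(u)/Q_1(u),P_2(u)/Q_2(u)\big)$ is a generic point of $\mathcal C$, i.e. $\operatorname{sat}(A)$ is exactly the set of all $f\in\mathcal F\{x,y\}$ that vanish at this point. Let $A,B\in\mathcal F\{x,y\}\setminus\mathcal F$ be linear differential polynomials (of total degree at most $1$ in the $x^{(k)},y^{(k)}$, a constant term from $\mathcal F$ being allowed). 1. If $A\in[B]$ and $\operatorname{ord}(A)>\operatorname{ord}(B)$, then $(\mathcal C,A)$ is not unirational. 2. If $A$ is unirational and $[A]\subseteq[B]$, then $[A]=[B]$. -/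

import Mathlib

open scoped Differential

/-! ### Differential polynomials -/

/-- The differential polynomial ring `F{y_j : j ∈ σ}` as a commutative ring: the polynomial ring
in the variables `(j, k)`, where `(j, k)` stands for the derivative `y_j^{(k)}`. -/
abbrev DiffPoly (F : Type*) (σ : Type*) [CommRing F] : Type _ := MvPolynomial (σ × ℕ) F

namespace DiffPoly

/-- Apply the derivation of `F` to every coefficient, as an additive map. -/
noncomputable def mapCoeffAddHom (F : Type*) (ι : Type*) [CommRing F] [Differential F] :
    MvPolynomial ι F →+ MvPolynomial ι F :=
  (AddMonoidAlgebra.coeffAddEquiv (R := F) (M := ι →₀ ℕ)).symm.toAddMonoidHom.comp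
    ((Finsupp.mapRange.addMonoidHom
      (Differential.deriv : Derivation ℤ F F).toLinearMap.toAddMonoidHom).comp
      (AddMonoidAlgebra.coeffAddEquiv (R := F) (M := ι →₀ ℕ)).toAddMonoidHom)

theorem coeff_mapCoeffAddHom {F : Type*} {ι : Type*} [CommRing F] [Differential F]
    (p : MvPolynomial ι F) (s : ι →₀ ℕ) :
    (mapCoeffAddHom F ι p).coeff s = (p.coeff s)′ := rfl

theorem mapCoeffAddHom_monomial {F : Type*} {ι : Type*} [CommRing F] [Differential F]
    (s : ι →₀ ℕ) (a : F) :
    mapCoeffAddHom F ι (MvPolynomial.monomial s a) = MvPolynomial.monomial s a′ := by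
  classical
  ext t
  rw [coeff_mapCoeffAddHom, MvPolynomial.coeff_monomial, MvPolynomial.coeff_monomial]
  split_ifs <;> simp

/-- Apply the derivation of `F` to every coefficient, as a derivation. -/
noncomputable def mapCoeffDeriv (F : Type*) (ι : Type*) [CommRing F] [Differential F] :
    Derivation ℤ (MvPolynomial ι F) (MvPolynomial ι F) :=
  Derivation.mk' (mapCoeffAddHom F ι).toIntLinearMap (by
    intro p q
    simp only [AddMonoidHom.coe_toIntLinearMap, smul_eq_mul]
    induction p using MvPolynomial.induction_on' with
    | add p₁ p₂ h₁ h₂ => simp only [add_mul, map_add, h₁, h₂, mul_add]; ring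
    | monomial s a =>
      induction q using MvPolynomial.induction_on' with
      | add q₁ q₂ h₁ h₂ => simp only [mul_add, map_add, h₁, h₂, add_mul]; ring
      | monomial t b =>
        simp only [MvPolynomial.monomial_mul, mapCoeffAddHom_monomial, Derivation.leibniz,
          smul_eq_mul, map_add]
        rw [add_comm t s, mul_comm b])

/-- The derivation `δ` of `F{y_j : j ∈ σ}`: it extends the derivation of `F` and sends
`y_j^{(k)}` to `y_j^{(k+1)}`. -/
noncomputable instance instDifferential (F : Type*) (σ : Type*) [CommRing F] [Differential F] :
    Differential (DiffPoly F σ) where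
  deriv := mapCoeffDeriv F (σ × ℕ) +
    (MvPolynomial.mkDerivation F
      fun v : σ × ℕ => (MvPolynomial.X (v.1, v.2 + 1) : DiffPoly F σ)).restrictScalars ℤ

theorem deriv_C {F : Type*} {σ : Type*} [CommRing F] [Differential F] (a : F) :
    (MvPolynomial.C a : DiffPoly F σ)′ = MvPolynomial.C a′ := by
  change mapCoeffAddHom F (σ × ℕ) (MvPolynomial.C a) + MvPolynomial.mkDerivation F _ _ = _
  rw [MvPolynomial.derivation_C, add_zero]
  exact mapCoeffAddHom_monomial 0 a

theorem deriv_X {F : Type*} {σ : Type*} [CommRing F] [Differential F] (j : σ) (k : ℕ) :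
    (MvPolynomial.X (j, k) : DiffPoly F σ)′ = MvPolynomial.X (j, k + 1) := by
  change mapCoeffAddHom F (σ × ℕ) (MvPolynomial.X (j, k)) + MvPolynomial.mkDerivation F _ _ = _
  rw [MvPolynomial.mkDerivation_X, MvPolynomial.X, mapCoeffAddHom_monomial]
  simp

instance instDifferentialAlgebra (F : Type*) (σ : Type*) [CommRing F] [Differential F] :
    DifferentialAlgebra F (DiffPoly F σ) := ⟨deriv_C⟩

/-- `ord_{y_j} f`: the largest `k` such that `y_j^{(k)}` appears in `f`, and `⊥` (that is, `-∞`)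
if none appears. -/
noncomputable def ordAt {F : Type*} {σ : Type*} [CommRing F] (j : σ) (f : DiffPoly F σ) :
    WithBot ℕ :=
  open scoped Classical in (f.vars.filter fun v => v.1 = j).sup fun v => (v.2 : WithBot ℕ)

/-- `ord f = max_j ord_{y_j} f`. -/
noncomputable def ord {F : Type*} {σ : Type*} [Fintype σ] [CommRing F] (f : DiffPoly F σ) :
    WithBot ℕ :=
  Finset.univ.sup fun j => ordAt j f

/-- Linear differential polynomials: total degree at most one in all the `y_j^{(k)}` (a constant
term is allowed). -/
def IsLinear {F : Type*} {σ : Type*} [CommRing F] (f : DiffPoly F σ) : Prop :=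
  f.totalDegree ≤ 1

/-- The value `f(η)` of a differential polynomial at a point `η`: each `y_j^{(k)}` is replaced by
`δ^k(η_j)`. -/
noncomputable def diffEval {F : Type*} {σ : Type*} {E : Type*} [CommRing F] [CommRing E]
    [Differential E] [Algebra F E] (η : σ → E) : DiffPoly F σ →ₐ[F] E :=
  MvPolynomial.aeval fun v : σ × ℕ => (Differential.deriv : Derivation ℤ E E)^[v.2] (η v.1)

end DiffPoly

/-! ### Differential ideals -/

/-- A differential ideal is an ideal closed under the derivation. -/
def IsDiffIdeal {R : Type*} [CommRing R] [Differential R] (I : Ideal R) : Prop :=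
  ∀ f ∈ I, f′ ∈ I

/-- The differential ideal `[Σ]` generated by a set. -/
def diffSpan {R : Type*} [CommRing R] [Differential R] (S : Set R) : Ideal R :=
  sInf {I : Ideal R | IsDiffIdeal I ∧ S ⊆ I}

/-! ### Rankings and saturation ideals -/

/-- A ranking: a strict total order on the derivatives `y_j^{(k)}` with `u < δu`, and
`u < v → δu < δv`. -/
structure Ranking (σ : Type*) where
  lt : σ × ℕ → σ × ℕ → Prop
  isStrictTotalOrder : IsStrictTotalOrder (σ × ℕ) lt
  lt_deriv : ∀ u : σ × ℕ, lt u (u.1, u.2 + 1)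
  deriv_lt_deriv : ∀ u v : σ × ℕ, lt u v → lt (u.1, u.2 + 1) (v.1, v.2 + 1)

namespace DiffPoly

/-- `v` is the leader of `f`: the highest ranked derivative appearing in `f`. -/
def IsLeader {F : Type*} {σ : Type*} [CommRing F] (R : Ranking σ) (f : DiffPoly F σ)
    (v : σ × ℕ) : Prop :=
  v ∈ f.vars ∧ ∀ w ∈ f.vars, w ≠ v → R.lt w v

/-- The leading coefficient of `f`, viewed as a univariate polynomial in the variable `v`. For `v`
the leader of `f` this is the initial of `f`. -/
noncomputable def initial {F : Type*} {σ : Type*} [CommRing F] (f : DiffPoly F σ)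
    (v : σ × ℕ) : DiffPoly F σ :=
  ∑ s ∈ f.support with s v = f.degreeOf v, MvPolynomial.monomial (s.erase v) (f.coeff s)

/-- The partial derivative of `f` with respect to `v`. For `v` the leader of `f` this is the
separant of `f`. -/
noncomputable def separant {F : Type*} {σ : Type*} [CommRing F] (f : DiffPoly F σ)
    (v : σ × ℕ) : DiffPoly F σ :=
  MvPolynomial.pderiv v f

/-- The saturation ideal `sat(A) = [A] : H_A^∞` with respect to a ranking, where `H_A` is the
product of the separant and the initial of `A`. For `A` irreducible it is the general component
of `A`. -/
def sat {F : Type*} {σ : Type*} [CommRing F] [Differential F] (R : Ranking σ)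
    (A : DiffPoly F σ) : Set (DiffPoly F σ) :=
  {f | ∃ v, IsLeader R A v ∧ ∃ m : ℕ, (separant A v * initial A v) ^ m * f ∈ diffSpan {A}}

end DiffPoly

/-! ### Differential field extensions -/

/-- `Θ(S)`: all derivatives (of order `≥ 0`) of the elements of `S`. -/
def derivSet {E : Type*} [CommRing E] [Differential E] (S : Set E) : Set E :=
  {b | ∃ a ∈ S, ∃ k : ℕ, b = (Differential.deriv : Derivation ℤ E E)^[k] a}

/-- `F⟨S⟩ = F(Θ(S))`, the differential subfield generated by `S` over `F`. -/
def diffAdjoin (F : Type*) {E : Type*} [Field F] [Field E] [Differential E] [Algebra F E]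
    (S : Set E) : IntermediateField F E :=
  IntermediateField.adjoin F (derivSet S)

theorem deriv_mem_diffAdjoin {F : Type*} {E : Type*} [Field F] [Differential F] [Field E]
    [Differential E] [Algebra F E] [DifferentialAlgebra F E] (S : Set E) {a : E}
    (ha : a ∈ diffAdjoin F S) : a′ ∈ diffAdjoin F S := by
  unfold diffAdjoin at ha ⊢
  induction ha using IntermediateField.adjoin_induction with
  | mem x hx =>
    obtain ⟨a, ha, k, rfl⟩ := hx
    refine IntermediateField.subset_adjoin _ _ ⟨a, ha, k + 1, ?_⟩
    rw [Function.iterate_succ_apply']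
  | algebraMap x =>
    rw [deriv_algebraMap]
    exact IntermediateField.algebraMap_mem _ _
  | add x y _ _ hx hy => rw [map_add]; exact add_mem hx hy
  | inv x hx' hx =>
    rw [Derivation.leibniz_inv]
    exact mul_mem (neg_mem (pow_mem (inv_mem hx') 2)) hx
  | mul x y hx' hy' hx hy =>
    rw [Derivation.leibniz]
    exact add_mem (mul_mem hx' hy) (mul_mem hy' hx)

/-- The derivation of `F⟨S⟩` is the restriction of that of the ambient field. -/
instance diffAdjoin.instDifferential {F : Type*} {E : Type*} [Field F] [Differential F] [Field E]
    [Differential E] [Algebra F E] [DifferentialAlgebra F E] (S : Set E) :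
    Differential (diffAdjoin F S) where
  deriv := Derivation.mk'
    ({ toFun := fun a => ⟨(a : E)′, deriv_mem_diffAdjoin S a.2⟩
       map_zero' := by ext; simp
       map_add' := fun a b => by ext; simp } :
      diffAdjoin F S →+ diffAdjoin F S).toIntLinearMap
    (fun a b => by ext; simp)

/-- `E` is a universal differential extension field of `F`: for all finitely generated
differential extension fields `K = F⟨s⟩` of `F` in `E`, every finitely generated differential
extension field `G = K⟨t⟩` of `K` (not necessarily inside `E`) embeds into `E` over `K`. -/
def IsUniversalDiffExt.{u, v} (F : Type u) (E : Type v) [Field F] [Differential F] [Field E]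
    [Differential E] [Algebra F E] [DifferentialAlgebra F E] : Prop :=
  ∀ (s : Finset E) (G : Type v) [Field G] [Differential G] [Algebra (diffAdjoin F (s : Set E)) G]
    [DifferentialAlgebra (diffAdjoin F (s : Set E)) G],
    (∃ t : Finset G, diffAdjoin (diffAdjoin F (s : Set E)) (t : Set G) = ⊤) →
    ∃ φ : G →ₐ[diffAdjoin F (s : Set E)] E, ∀ g : G, φ g′ = (φ g)′

/-- `u` is differentially transcendental over `F`: the family `u, u', u'', …` is algebraically
independent over `F`. -/
def DiffTranscendental (F : Type*) {E : Type*} [Field F] [Field E] [Differential E] [Algebra F E]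
    (u : E) : Prop :=
  AlgebraicIndependent F fun k : ℕ => (Differential.deriv : Derivation ℤ E E)^[k] u

/-! ### Unirational differential curves -/

/-- `η` is a generic point of the differential ideal `P` over `F`: a differential polynomial over
`F` vanishes at `η` exactly when it belongs to `P`. -/
def IsDiffGenericPoint {F : Type*} {E : Type*} {σ : Type*} [CommRing F] [CommRing E] [Differential E]
    [Algebra F E] (η : σ → E) (P : Set (DiffPoly F σ)) : Prop :=
  {f : DiffPoly F σ | DiffPoly.diffEval η f = 0} = P

/-- The plane differential curve `(𝒞, A)`, that is, `𝒞 = 𝕍(sat(A)) ⊆ 𝔸²(E)`, is unirational: it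
has a generic point `(P₁(u)/Q₁(u), P₂(u)/Q₂(u))` with `u ∈ E` differentially transcendental over
`F` and with coprime `Pᵢ, Qᵢ ∈ F{u}` (`Qᵢ ≠ 0`). -/
def IsUnirational {F : Type*} (E : Type*) [Field F] [Differential F] [Field E] [Differential E]
    [Algebra F E] (R : Ranking (Fin 2)) (A : DiffPoly F (Fin 2)) : Prop :=
  ∃ (u : E) (P Q : Fin 2 → DiffPoly F Unit),
    DiffTranscendental F u ∧
    (∀ i, Q i ≠ 0 ∧ IsRelPrime (P i) (Q i)) ∧
    IsDiffGenericPoint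
      (fun i => DiffPoly.diffEval (fun _ => u) (P i) / DiffPoly.diffEval (fun _ => u) (Q i))
      (DiffPoly.sat R A)

/-! The proof turns membership in `[B]` into a linear differential equation over `F⟨u⟩`. A linear
element of `[B]` is an `F`-linear combination of derivatives of `B`
(`IsLinearWithTop.mem_derivSpan_of_mem_diffSpan`), so `A ∈ [B]` gives `A = ∑ c_k δ^k B`. If `A` is
unirational with generic point `η`, then `w = B(η)` lies in `F⟨u⟩` and `∑ c_k w^{(k)} = 0`.

Such a `w` lies in `F` (`mem_range_algebraMap_of_sum_iterate_deriv_eq_zero`): a reduced fraction of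
order `N` in `u` has `k`-th derivative of order exactly `N + k`, so the highest derivative cannot
cancel. Hence some `B - c` vanishes at `η` and lies in `sat(A)`, which is contained in `[A]` because
the initial and separant of a linear `A` are nonzero constants. A nonzero linear element of `[A]`
has order at least `ord A`; if `ord B < ord A`, this forces `B = c`, a contradiction.

For the second claim, the first gives `ord A ≤ ord B`. Comparing top coefficients then makes `A` a
nonzero scalar multiple of `B`. -/

namespace DiffPoly

open MvPolynomial

/-! ### Evaluation at a point as a differential homomorphism. -/

section Evaluation

variable {F E σ : Type*} [Field F] [Field E] [Differential E] [Algebra F E]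

theorem diffEval_C (η : σ → E) (a : F) : diffEval η (C a : DiffPoly F σ) = algebraMap F E a :=
  MvPolynomial.aeval_C _ _

theorem diffEval_X (η : σ → E) (v : σ × ℕ) :
    diffEval η (X v : DiffPoly F σ) = (Differential.deriv : Derivation ℤ E E)^[v.2] (η v.1) :=
  MvPolynomial.aeval_X _ _

theorem diffEval_injective_of_diffTranscendental {u : E} (hu : DiffTranscendental F u) :
    Function.Injective (diffEval (fun _ => u) : DiffPoly F Unit →ₐ[F] E) :=
  AlgebraicIndependent.comp hu (fun v : Unit × ℕ => v.2) (Equiv.punitProd ℕ).injective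

variable [Differential F] [DifferentialAlgebra F E]

theorem diffEval_deriv (η : σ → E) (f : DiffPoly F σ) : diffEval η f′ = (diffEval η f)′ := by
  induction f using MvPolynomial.induction_on with
  | C a => rw [deriv_C, diffEval_C, diffEval_C, deriv_algebraMap]
  | add p q hp hq => simp only [map_add, hp, hq]
  | mul_X p v hp =>
    obtain ⟨j, k⟩ := v
    simp only [Derivation.leibniz, deriv_X, smul_eq_mul, map_add, map_mul, hp, diffEval_X,
      Function.iterate_succ_apply']

theorem diffEval_iterate_deriv (η : σ → E) (m : ℕ) (f : DiffPoly F σ) :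
    diffEval η ((Differential.deriv : Derivation ℤ (DiffPoly F σ) (DiffPoly F σ))^[m] f) =
      (Differential.deriv : Derivation ℤ E E)^[m] (diffEval η f) := by
  induction m with
  | zero => rfl
  | succ m ih => rw [Function.iterate_succ_apply', diffEval_deriv, ih, Function.iterate_succ_apply']

end Evaluation

/-! ### Partial derivatives and their commutator with the derivation. -/

section PartialDerivatives

variable {F σ : Type*} [Field F]

/-- The commutator of the two derivations only needs checking on the variables. It is how the top
partial derivative is tracked under `δ`. -/
theorem pderiv_deriv_succ [Differential F] (j : σ) (k : ℕ) (f : DiffPoly F σ) :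
    pderiv (j, k + 1) f′ = (pderiv (j, k + 1) f)′ + pderiv (j, k) f := by
  classical
  induction f using MvPolynomial.induction_on with
  | C a => simp [deriv_C]
  | add p q hp hq => simp only [map_add, hp, hq]; ring
  | mul_X p v hp =>
    obtain ⟨i, l⟩ := v
    have h : (pderiv (j, k + 1) (X (i, l) : DiffPoly F σ))′ = 0 := by
      rw [pderiv_X, Pi.single_apply]; split_ifs <;> simp
    have h' : (pderiv (j, k + 1) (X (i, l + 1)) : DiffPoly F σ) = pderiv (j, k) (X (i, l)) := by
      simp [pderiv_X, Pi.single_apply]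
    simp only [Derivation.leibniz, deriv_X, smul_eq_mul, map_add, hp, h, h']
    ring

theorem pderiv_ne_zero_of_mem_vars [CharZero F] {ι : Type*} {f : MvPolynomial ι F} {v : ι}
    (hv : v ∈ f.vars) : pderiv v f ≠ 0 := by
  classical
  obtain ⟨d, hd, hvd⟩ := (mem_vars_iff_mem_support v).1 hv
  intro h
  have h1 := coeff_pderiv (i := v) f (d - Finsupp.single v 1)
  have h2 : d - Finsupp.single v 1 + Finsupp.single v 1 = d :=
    tsub_add_cancel_of_le (by simpa [Nat.one_le_iff_ne_zero] using hvd)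
  rw [h, h2] at h1
  simp only [coeff_zero] at h1
  rcases mul_eq_zero.1 h1.symm with h3 | h3
  · exact (mem_support_iff.1 hd) h3
  · exact Nat.cast_add_one_ne_zero _ h3

/-- Differentiating in `v` lowers the degree in `v`, so a nonzero result cannot be a multiple of
`f`. -/
theorem pderiv_eq_zero_of_dvd {ι : Type*} {f : MvPolynomial ι F} {v : ι}
    (h : f ∣ pderiv v f) : pderiv v f = 0 := by
  by_contra h0
  obtain ⟨g, hg⟩ := h
  have hf : f ≠ 0 := by rintro rfl; simp at h0
  have hg0 : g ≠ 0 := by rintro rfl; simp [hg] at h0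
  have hv : v ∈ f.vars := by
    by_contra hv
    exact h0 (pderiv_eq_zero_of_notMem_vars hv)
  have h1 : degreeOf v f ≠ 0 := mem_vars_iff_degreeOf_ne_zero.1 hv
  have h2 : degreeOf v (pderiv v f) < degreeOf v f := by
    rw [degreeOf_lt_iff (Nat.pos_of_ne_zero h1)]
    intro m hm
    rw [mem_support_iff, coeff_pderiv] at hm
    have h3 := monomial_le_degreeOf v (mem_support_iff.2 (left_ne_zero_of_mul hm))
    simp at h3
    omega
  rw [hg, degreeOf_mul_eq hf hg0] at h2
  omega

end PartialDerivatives

/-! ### Fractions of differential polynomials in `u`. -/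

section DiffFractions

variable {F E : Type*} [Field F] [Field E] [Differential E] [Algebra F E]

/-- The fractions `P(u) / Q(u)` of differential polynomials. -/
def IsDiffFraction (F : Type*) {E : Type*} [Field F] [Field E] [Differential E]
    [Algebra F E] (u w : E) : Prop :=
  ∃ P Q : DiffPoly F Unit, Q ≠ 0 ∧ w = diffEval (fun _ => u) P / diffEval (fun _ => u) Q

theorem IsDiffFraction.algebraMap (u : E) (a : F) : IsDiffFraction F u (algebraMap F E a) :=
  ⟨C a, 1, one_ne_zero, by rw [diffEval_C, map_one, div_one]⟩

theorem IsDiffFraction.algebraMap_mul {u w : E} (a : F) (hw : IsDiffFraction F u w) :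
    IsDiffFraction F u (Algebra.algebraMap F E a * w) := by
  obtain ⟨P, Q, hQ, rfl⟩ := hw
  exact ⟨C a * P, Q, hQ, by rw [map_mul, diffEval_C, mul_div_assoc]⟩

theorem IsDiffFraction.add {u w w' : E} (hu : DiffTranscendental F u) (hw : IsDiffFraction F u w)
    (hw' : IsDiffFraction F u w') : IsDiffFraction F u (w + w') := by
  have hinj := diffEval_injective_of_diffTranscendental hu
  obtain ⟨P, Q, hQ, rfl⟩ := hw
  obtain ⟨P', Q', hQ', rfl⟩ := hw'
  refine ⟨P * Q' + Q * P', Q * Q', mul_ne_zero hQ hQ', ?_⟩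
  rw [div_add_div _ _ ((map_ne_zero_iff _ hinj).2 hQ) ((map_ne_zero_iff _ hinj).2 hQ')]
  simp only [map_add, map_mul]

end DiffFractions

/-! ### Linear differential equations in `F⟨u⟩`. -/

section DiffRationalFunctions

variable {F E : Type*} [Field F] [Differential F] [Field E] [Differential E] [Algebra F E]
  [DifferentialAlgebra F E]

/-- The numerator of the `m`-th derivative of `P / Q` over the denominator `Q ^ (m + 1)`. -/
noncomputable def derivNum (P Q : DiffPoly F Unit) : ℕ → DiffPoly F Unit
  | 0 => P
  | m + 1 => Q * (derivNum P Q m)′ - (m + 1 : ℕ) * Q′ * derivNum P Q m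

theorem diffEval_derivNum {u w : E} {P Q : DiffPoly F Unit}
    (h : w * diffEval (fun _ => u) Q = diffEval (fun _ => u) P) (m : ℕ) :
    (Differential.deriv : Derivation ℤ E E)^[m] w * diffEval (fun _ => u) Q ^ (m + 1) =
      diffEval (fun _ => u) (derivNum P Q m) := by
  induction m with
  | zero => simpa [derivNum] using h
  | succ m ih =>
    have h' := congrArg (fun x => x′) ih
    simp only [Derivation.leibniz, Derivation.leibniz_pow, smul_eq_mul, nsmul_eq_mul,
      Nat.add_sub_cancel] at h'
    rw [Function.iterate_succ_apply', derivNum, map_sub, map_mul, map_mul, map_mul, map_natCast,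
      diffEval_deriv, diffEval_deriv, ← h', ← ih]
    ring

theorem pderiv_derivNum_eq_zero {P Q : DiffPoly F Unit} {N : ℕ}
    (hP : ∀ k, N < k → pderiv ((), k) P = 0) (hQ : ∀ k, N < k → pderiv ((), k) Q = 0)
    (m k : ℕ) (hk : N + m < k) : pderiv ((), k) (derivNum P Q m) = 0 := by
  induction m generalizing k with
  | zero => exact hP k hk
  | succ m ih =>
    obtain ⟨k, rfl⟩ : ∃ l, k = l + 1 := ⟨k - 1, by omega⟩
    have h1 : pderiv ((), k + 1) ((m + 1 : ℕ) : DiffPoly F Unit) = 0 := Derivation.map_natCast _ _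
    simp only [derivNum, map_sub, Derivation.leibniz, smul_eq_mul, pderiv_deriv_succ,
      ih (k + 1) (by omega), ih k (by omega), hQ (k + 1) (by omega), hQ k (by omega), h1]
    simp

/-- Each further derivative contributes only a factor `Q`, since every other term has too low an
order. The formula starts at the first derivative: the numerator of order `0` is `P` alone and does
not see `Q`. -/
theorem pderiv_derivNum_succ {P Q : DiffPoly F Unit} {N : ℕ}
    (hP : ∀ k, N < k → pderiv ((), k) P = 0) (hQ : ∀ k, N < k → pderiv ((), k) Q = 0) (m : ℕ) :
    pderiv ((), N + (m + 1)) (derivNum P Q (m + 1)) =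
      Q ^ m * (Q * pderiv ((), N) P - P * pderiv ((), N) Q) := by
  induction m with
  | zero =>
    have h1 : pderiv ((), N + 1) ((0 + 1 : ℕ) : DiffPoly F Unit) = 0 := Derivation.map_natCast _ _
    simp only [derivNum, map_sub, Derivation.leibniz, smul_eq_mul, pderiv_deriv_succ, zero_add,
      hP (N + 1) (by omega), hQ (N + 1) (by omega)] at h1 ⊢
    simp
  | succ m ih =>
    have h1 : pderiv ((), N + (m + 1) + 1) ((m + 1 + 1 : ℕ) : DiffPoly F Unit) = 0 :=
      Derivation.map_natCast _ _
    rw [derivNum, ← add_assoc N]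
    simp only [map_sub, Derivation.leibniz, smul_eq_mul, pderiv_deriv_succ, ih,
      hQ (N + (m + 1)) (by omega), hQ (N + (m + 1) + 1) (by omega), h1,
      pderiv_derivNum_eq_zero hP hQ (m + 1) (N + (m + 1) + 1) (by omega)]
    simp only [map_zero]
    ring

/-- In `F⟨u⟩` with `u` differentially transcendental, the only solutions of nonzero homogeneous
linear differential equations over `F` are the elements of `F`. -/
theorem mem_range_algebraMap_of_sum_iterate_deriv_eq_zero [CharZero F] {u w : E}
    (hu : DiffTranscendental F u) {P Q : DiffPoly F Unit} (hQ : Q ≠ 0)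
    (hw : w = diffEval (fun _ => u) P / diffEval (fun _ => u) Q) {M : ℕ} {c : ℕ → F}
    (hc : c M ≠ 0)
    (h : ∑ k ∈ Finset.range (M + 1),
      algebraMap F E (c k) * (Differential.deriv : Derivation ℤ E E)^[k] w = 0) :
    w ∈ Set.range (algebraMap F E) := by
  classical
  have hinj := diffEval_injective_of_diffTranscendental hu
  have hev : ∀ f : DiffPoly F Unit, f ≠ 0 → diffEval (fun _ => u) f ≠ 0 := fun f hf =>
    (map_ne_zero_iff _ hinj).2 hf
  -- Lowest terms are essential: coprimality rules out cancellation in the top partial derivative.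
  obtain ⟨Q', P', g, hrel, rfl, rfl⟩ := UniqueFactorizationMonoid.exists_reduced_factors Q hQ P
  have hg : g ≠ 0 := left_ne_zero_of_mul hQ
  have hQ' : Q' ≠ 0 := right_ne_zero_of_mul hQ
  rw [map_mul, map_mul, mul_div_mul_left _ _ (hev g hg)] at hw
  have hw' : w * diffEval (fun _ => u) Q' = diffEval (fun _ => u) P' := by
    rw [hw, div_mul_cancel₀ _ (hev _ hQ')]
  by_cases hv : P'.vars ∪ Q'.vars = ∅
  · obtain ⟨hvP, hvQ⟩ := Finset.union_eq_empty.1 hv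
    rw [vars_eq_empty_iff_eq_C] at hvP hvQ
    refine ⟨coeff 0 P' / coeff 0 Q', ?_⟩
    rw [hw, map_div₀]
    conv_rhs => rw [hvP, hvQ, diffEval_C, diffEval_C]
  exfalso
  obtain ⟨⟨⟨⟩, N⟩, hN, hmax⟩ :=
    Finset.exists_max_image (P'.vars ∪ Q'.vars) Prod.snd (Finset.nonempty_iff_ne_empty.2 hv)
  have hP0 : ∀ k, N < k → pderiv ((), k) P' = 0 := fun k hk =>
    pderiv_eq_zero_of_notMem_vars fun hm =>
      absurd (hmax _ (Finset.mem_union_left _ hm)) (not_le.2 hk)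
  have hQ0 : ∀ k, N < k → pderiv ((), k) Q' = 0 := fun k hk =>
    pderiv_eq_zero_of_notMem_vars fun hm =>
      absurd (hmax _ (Finset.mem_union_right _ hm)) (not_le.2 hk)
  -- The equation multiplied by `Q'(u)^(M + 1)`, read as an identity of differential polynomials.
  have hpoly : ∑ k ∈ Finset.range (M + 1), C (c k) * (Q' ^ (M - k) * derivNum P' Q' k) = 0 := by
    apply hinj
    rw [map_zero, ← mul_zero (diffEval (fun _ => u) Q' ^ (M + 1)), ← h, map_sum, Finset.mul_sum]
    refine Finset.sum_congr rfl fun k hk => ?_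
    have hk' : k ≤ M := by simpa [Nat.lt_succ_iff] using hk
    rw [map_mul, map_mul, diffEval_C, map_pow, ← diffEval_derivNum hw',
      show M + 1 = (M - k) + (k + 1) by omega, pow_add]
    ring
  -- An equation of order `0` gives `P' = 0`, so `Q'` is a unit and no variable occurs at all.
  rcases M with _ | M
  · have hP' : P' = 0 := by simpa [derivNum, hc] using hpoly
    have hunit : IsUnit Q' := hrel dvd_rfl (hP' ▸ dvd_zero _)
    obtain ⟨a, -, ha⟩ := MvPolynomial.isUnit_iff_eq_C_of_isReduced.1 hunit
    rw [hP', ha] at hv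
    simp at hv
  -- Only the highest derivative of `w` involves `u^{(N + M + 1)}`.
  have hd := congrArg (pderiv ((), N + (M + 1))) hpoly
  rw [Finset.sum_range_succ, map_add, map_sum, Finset.sum_eq_zero, zero_add, map_zero,
    pderiv_C_mul, Nat.sub_self, pow_zero, one_mul, pderiv_derivNum_succ hP0 hQ0] at hd
  -- By coprimality each of `P'`, `Q'` divides its own partial derivative, so both partials vanish,
  -- although `u^{(N)}` occurs in one of the two.
  · have hkey : Q' * pderiv ((), N) P' = P' * pderiv ((), N) Q' := by
      simpa [hc, hQ', sub_eq_zero] using hd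
    have h1 : pderiv ((), N) Q' = 0 := pderiv_eq_zero_of_dvd
      (hrel.dvd_of_dvd_mul_left (Dvd.intro _ hkey))
    have h2 : pderiv ((), N) P' = 0 := pderiv_eq_zero_of_dvd
      (hrel.symm.dvd_of_dvd_mul_left (Dvd.intro _ hkey.symm))
    rcases Finset.mem_union.1 hN with hm | hm
    · exact pderiv_ne_zero_of_mem_vars hm h2
    · exact pderiv_ne_zero_of_mem_vars hm h1
  · intro k hk
    have hk' : k < M + 1 := by simpa using hk
    rw [pderiv_C_mul, pderiv_mul, pderiv_pow, hQ0 _ (by omega),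
      pderiv_derivNum_eq_zero hP0 hQ0 k _ (by omega)]
    simp

theorem IsDiffFraction.deriv {u w : E} (hw : IsDiffFraction F u w) : IsDiffFraction F u w′ := by
  obtain ⟨P, Q, hQ, rfl⟩ := hw
  refine ⟨Q * P′ - P * Q′, Q ^ 2, pow_ne_zero _ hQ, ?_⟩
  rw [Derivation.leibniz_div]
  simp only [map_sub, map_mul, map_pow, diffEval_deriv, smul_eq_mul]
  rw [div_eq_inv_mul, inv_pow]

theorem IsDiffFraction.iterate_deriv {u w : E} (hw : IsDiffFraction F u w) (m : ℕ) :
    IsDiffFraction F u ((Differential.deriv : Derivation ℤ E E)^[m] w) := by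
  induction m with
  | zero => exact hw
  | succ m ih => rw [Function.iterate_succ_apply']; exact ih.deriv

end DiffRationalFunctions

/-! ### Linear differential polynomials and the ideals they generate. -/

section Linear

variable {F σ : Type*} [Field F]

theorem IsLinear.eq_zero_or_eq_single {f : DiffPoly F σ} (hf : f.IsLinear) {s : σ × ℕ →₀ ℕ}
    (hs : s ∈ f.support) : s = 0 ∨ ∃ v, s = Finsupp.single v 1 := by
  have h : s.degree ≤ 1 := (le_totalDegree hs).trans hf
  rcases Nat.le_one_iff_eq_zero_or_eq_one.1 h with h | h
  · exact .inl ((Finsupp.degree_eq_zero_iff s).1 h)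
  · exact .inr (by simpa [eq_comm] using (Finsupp.sum_eq_one_iff s).1 h)

theorem IsLinear.induction {p : DiffPoly F σ → Prop} (hC : ∀ a, p (C a))
    (hX : ∀ a v, p (C a * X v)) (hadd : ∀ f g, p f → p g → p (f + g)) {f : DiffPoly F σ}
    (hf : f.IsLinear) : p f := by
  rw [f.as_sum]
  refine Finset.sum_induction _ p hadd (by simpa using hC 0) fun s hs => ?_
  rcases hf.eq_zero_or_eq_single hs with h | ⟨v, h⟩
  · rw [h]; exact hC _
  · rw [h, ← C_mul_X_eq_monomial]; exact hX _ _

theorem IsLinear.mem_vars_iff {f : DiffPoly F σ} (hf : f.IsLinear) {v : σ × ℕ} :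
    v ∈ f.vars ↔ coeff (Finsupp.single v 1) f ≠ 0 := by
  rw [mem_vars_iff_mem_support]
  constructor
  · rintro ⟨d, hd, hvd⟩
    rcases hf.eq_zero_or_eq_single hd with h | ⟨w, h⟩
    · simp [h] at hvd
    · rw [h, Finsupp.support_single _ one_ne_zero, Finset.mem_singleton] at hvd
      rw [hvd, ← h]
      exact mem_support_iff.1 hd
  · intro h
    exact ⟨_, mem_support_iff.2 h, by simp⟩

theorem isLinear_C (a : F) : IsLinear (C a : DiffPoly F σ) := by
  simp [IsLinear]

theorem isLinear_X (v : σ × ℕ) : IsLinear (X v : DiffPoly F σ) := by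
  simp [IsLinear]

theorem IsLinear.add {f g : DiffPoly F σ} (hf : f.IsLinear) (hg : g.IsLinear) :
    (f + g).IsLinear :=
  (totalDegree_add f g).trans (max_le hf hg)

theorem IsLinear.C_mul {f : DiffPoly F σ} (a : F) (hf : f.IsLinear) :
    IsLinear (C a * f) :=
  (totalDegree_mul _ _).trans (by rw [totalDegree_C, zero_add]; exact hf)

theorem IsLinear.sub {f g : DiffPoly F σ} (hf : f.IsLinear) (hg : g.IsLinear) :
    (f - g).IsLinear :=
  (totalDegree_sub f g).trans (max_le hf hg)

/-- `f` is linear of order `n`, and `y_j^{(n)}` appears in `f`. -/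
structure IsLinearWithTop (f : DiffPoly F σ) (j : σ) (n : ℕ) : Prop where
  isLinear : f.IsLinear
  coeff_ne_zero : coeff (Finsupp.single (j, n) 1) f ≠ 0
  coeff_eq_zero : ∀ i k, n < k → coeff (Finsupp.single (i, k) 1) f = 0

theorem IsLinear.exists_isLinearWithTop {f : DiffPoly F σ} (hf : f.IsLinear)
    (hf' : f ∉ Set.range C) : ∃ j n, IsLinearWithTop f j n := by
  have hne : f.vars.Nonempty := by
    rw [Finset.nonempty_iff_ne_empty]
    intro h
    exact hf' ⟨_, (vars_eq_empty_iff_eq_C.1 h).symm⟩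
  obtain ⟨⟨j, n⟩, hv, hmax⟩ := Finset.exists_max_image f.vars Prod.snd hne
  refine ⟨j, n, hf, hf.mem_vars_iff.1 hv, fun i k hk => ?_⟩
  by_contra h
  exact absurd (hmax _ (hf.mem_vars_iff.2 h)) (not_le.2 hk)

theorem IsLinearWithTop.ord_eq [Fintype σ] {f : DiffPoly F σ} {j : σ} {n : ℕ}
    (h : IsLinearWithTop f j n) : f.ord = n := by
  classical
  refine le_antisymm ?_ ?_
  · refine Finset.sup_le fun i _ => Finset.sup_le fun v hv => ?_
    by_contra hlt
    exact h.isLinear.mem_vars_iff.1 (Finset.mem_filter.1 hv).1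
      (h.coeff_eq_zero v.1 v.2 (by simpa using hlt))
  · have h1 : ((j, n) : σ × ℕ) ∈ f.vars.filter fun v => v.1 = j :=
      Finset.mem_filter.2 ⟨h.isLinear.mem_vars_iff.2 h.coeff_ne_zero, rfl⟩
    have h2 : (n : WithBot ℕ) ≤ ordAt j f := by
      unfold ordAt
      convert Finset.le_sup (f := fun v : σ × ℕ => (v.2 : WithBot ℕ)) h1
    exact h2.trans (Finset.le_sup (f := fun j => ordAt j f) (Finset.mem_univ j))

/-- The polynomials in which none of the monomials `y_j^{(m)}`, `m ≥ n`, appears. -/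
def freeOf (F : Type*) {σ : Type*} [Field F] (j : σ) (n : ℕ) : Submodule F (DiffPoly F σ) where
  carrier := {f | ∀ m, n ≤ m → coeff (Finsupp.single (j, m) 1) f = 0}
  zero_mem' := fun _ _ => coeff_zero _
  add_mem' := fun hf hg m hm => by rw [coeff_add, hf m hm, hg m hm, add_zero]
  smul_mem' := fun a f hf m hm => by rw [coeff_smul, hf m hm, smul_zero]

theorem IsLinear.initial_eq {A : DiffPoly F σ} (hA : A.IsLinear) {v : σ × ℕ} (hv : v ∈ A.vars) :
    initial A v = C (coeff (Finsupp.single v 1) A) := by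
  classical
  have hc := hA.mem_vars_iff.1 hv
  have hdeg : A.degreeOf v = 1 :=
    le_antisymm ((degreeOf_le_totalDegree A v).trans hA)
      (Nat.one_le_iff_ne_zero.2 (mem_vars_iff_degreeOf_ne_zero.1 hv))
  have hfilter : A.support.filter (fun s => s v = A.degreeOf v) = {Finsupp.single v 1} := by
    ext s
    rw [Finset.mem_filter, Finset.mem_singleton, hdeg]
    constructor
    · rintro ⟨hs, hsv⟩
      rcases hA.eq_zero_or_eq_single hs with rfl | ⟨w, rfl⟩
      · simp at hsv
      · have : w = v := by
          by_contra hne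
          simp [hne] at hsv
        rw [this]
    · rintro rfl
      exact ⟨mem_support_iff.2 hc, by simp⟩
  unfold initial
  rw [hfilter, Finset.sum_singleton, Finsupp.erase_single]
  rfl

theorem IsLinear.separant_eq {A : DiffPoly F σ} (hA : A.IsLinear) (v : σ × ℕ) :
    separant A v = C (coeff (Finsupp.single v 1) A) := by
  classical
  refine hA.induction (p := fun A => separant A v = C (coeff (Finsupp.single v 1) A))
    (fun a => ?_) (fun a w => ?_) fun f g hf hg => ?_
  · simp [separant, coeff_C, eq_comm (a := (0 : σ × ℕ →₀ ℕ))]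
  · rw [separant, pderiv_C_mul, pderiv_X, coeff_C_mul, coeff_X, Pi.single_apply]
    simp only [Finsupp.single_left_inj one_ne_zero]
    split_ifs <;> simp
  · unfold separant at hf hg ⊢
    rw [map_add, hf, hg, coeff_add, C_add]

variable [Differential F]

theorem deriv_C_mul_X (a : F) (v : σ × ℕ) :
    (C a * X v : DiffPoly F σ)′ = C a * X (v.1, v.2 + 1) + C a′ * X v := by
  obtain ⟨i, k⟩ := v
  rw [Derivation.leibniz, deriv_X, deriv_C, smul_eq_mul, smul_eq_mul, mul_comm (X (i, k))]

theorem IsLinear.deriv {f : DiffPoly F σ} (hf : f.IsLinear) : IsLinear f′ := by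
  refine hf.induction (p := fun f => IsLinear f′) (fun a => ?_) (fun a v => ?_)
    fun f g hf hg => ?_
  · rw [deriv_C]; exact isLinear_C _
  · rw [deriv_C_mul_X]
    exact ((isLinear_X _).C_mul _).add ((isLinear_X _).C_mul _)
  · rw [map_add]; exact hf.add hg

theorem IsLinear.coeff_deriv_succ {f : DiffPoly F σ} (hf : f.IsLinear) (i : σ) (k : ℕ) :
    coeff (Finsupp.single (i, k + 1) 1) f′ =
      (coeff (Finsupp.single (i, k + 1) 1) f)′ + coeff (Finsupp.single (i, k) 1) f := by
  classical
  refine hf.induction (p := fun f => coeff (Finsupp.single (i, k + 1) 1) f′ =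
      (coeff (Finsupp.single (i, k + 1) 1) f)′ + coeff (Finsupp.single (i, k) 1) f)
    (fun a => ?_) (fun a v => ?_) fun f g hf hg => ?_
  · simp [deriv_C, coeff_C, eq_comm (a := (0 : σ × ℕ →₀ ℕ))]
  · obtain ⟨j, l⟩ := v
    simp only [deriv_C_mul_X, coeff_add, coeff_C_mul, coeff_X,
      Finsupp.single_left_inj one_ne_zero, Prod.mk.injEq, Nat.add_right_cancel_iff]
    split_ifs <;> simp [add_comm]
  · simp only [map_add, coeff_add, hf, hg]
    ring

theorem IsLinearWithTop.deriv {f : DiffPoly F σ} {j : σ} {n : ℕ} (h : IsLinearWithTop f j n) :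
    coeff (Finsupp.single (j, n + 1) 1) f′ = coeff (Finsupp.single (j, n) 1) f ∧
      IsLinearWithTop f′ j (n + 1) := by
  have h1 : coeff (Finsupp.single (j, n + 1) 1) f′ = coeff (Finsupp.single (j, n) 1) f := by
    rw [h.isLinear.coeff_deriv_succ, h.coeff_eq_zero _ _ n.lt_succ_self]; simp
  refine ⟨h1, IsLinear.deriv h.isLinear, h1 ▸ h.coeff_ne_zero, fun i k hk => ?_⟩
  obtain ⟨k, rfl⟩ : ∃ l, k = l + 1 := ⟨k - 1, by omega⟩
  rw [h.isLinear.coeff_deriv_succ, h.coeff_eq_zero _ _ (by omega), h.coeff_eq_zero _ _ (by omega)]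
  simp

theorem IsLinearWithTop.iterate_deriv {f : DiffPoly F σ} {j : σ} {n : ℕ}
    (h : IsLinearWithTop f j n) (m : ℕ) :
    IsLinearWithTop ((Differential.deriv : Derivation ℤ (DiffPoly F σ) (DiffPoly F σ))^[m] f) j
      (n + m) := by
  induction m with
  | zero => exact h
  | succ m ih => rw [Function.iterate_succ_apply']; exact ih.deriv.2

/-- The linear span over `F` of `f` and its derivatives. -/
noncomputable def derivSpan (f : DiffPoly F σ) : Submodule F (DiffPoly F σ) :=
  Submodule.span F (Set.range fun m : ℕ =>
    (Differential.deriv : Derivation ℤ (DiffPoly F σ) (DiffPoly F σ))^[m] f)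

theorem iterate_deriv_mem_derivSpan (f : DiffPoly F σ) (m : ℕ) :
    (Differential.deriv : Derivation ℤ (DiffPoly F σ) (DiffPoly F σ))^[m] f ∈ derivSpan f :=
  Submodule.subset_span ⟨m, rfl⟩

theorem exists_sum_of_mem_derivSpan {f g : DiffPoly F σ} (hg : g ∈ derivSpan f) (hg0 : g ≠ 0) :
    ∃ (M : ℕ) (c : ℕ → F), c M ≠ 0 ∧ g = ∑ k ∈ Finset.range (M + 1),
      C (c k) * (Differential.deriv : Derivation ℤ (DiffPoly F σ) (DiffPoly F σ))^[k] f := by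
  classical
  obtain ⟨c, rfl⟩ := Finsupp.mem_span_range_iff_exists_finsupp.1 hg
  have hne : c.support.Nonempty := by
    rw [Finset.nonempty_iff_ne_empty]
    intro h
    rw [Finsupp.support_eq_empty] at h
    simp [h] at hg0
  refine ⟨c.support.max' hne, c, Finsupp.mem_support_iff.1 (Finset.max'_mem _ _), ?_⟩
  rw [Finsupp.sum_of_support_subset c (s := Finset.range (c.support.max' hne + 1))]
  · simp only [smul_eq_C_mul]
  · intro k hk
    exact Finset.mem_range.2 (Nat.lt_succ_of_le (Finset.le_max' _ _ hk))
  · simp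

/-- If `δ^M B` is the highest derivative in a nonzero combination, it contains `y_j^{(n + M)}`,
which no lower derivative can cancel. -/
theorem IsLinearWithTop.eq_zero_of_mem {B f : DiffPoly F σ} {j : σ} {n : ℕ}
    (hB : IsLinearWithTop B j n) (hf : f ∈ derivSpan B) (hf' : f ∈ freeOf F j n) : f = 0 := by
  by_contra h0
  obtain ⟨M, c, hc, rfl⟩ := exists_sum_of_mem_derivSpan hf h0
  have h := hf' (n + M) (Nat.le_add_right _ _)
  rw [Finset.sum_range_succ, coeff_add, coeff_sum, Finset.sum_eq_zero, zero_add, coeff_C_mul] at h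
  · exact mul_ne_zero hc (hB.iterate_deriv M).coeff_ne_zero h
  · intro k hk
    rw [coeff_C_mul, (hB.iterate_deriv k).coeff_eq_zero _ _ (by simpa using hk), mul_zero]

/-- Division by `B`: the monomials `y_j^{(n + N - 1)}, …, y_j^{(n)}` are eliminated from the top
down, each with one derivative of `B`. -/
theorem IsLinearWithTop.exists_sub_mem {B : DiffPoly F σ} {j : σ} {n : ℕ}
    (hB : IsLinearWithTop B j n) (N : ℕ) (f : DiffPoly F σ)
    (hf : ∀ m, n + N ≤ m → coeff (Finsupp.single (j, m) 1) f = 0) :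
    ∃ r ∈ freeOf F j n, r - f ∈ derivSpan B := by
  induction N generalizing f with
  | zero => exact ⟨f, hf, by simp⟩
  | succ N ih =>
    set g := (Differential.deriv : Derivation ℤ (DiffPoly F σ) (DiffPoly F σ))^[N] B with hg
    have hgt : IsLinearWithTop g j (n + N) := hB.iterate_deriv N
    set a := coeff (Finsupp.single (j, n + N) 1) f / coeff (Finsupp.single (j, n + N) 1) g with ha
    obtain ⟨r, hr, hr'⟩ := ih (f - a • g) fun m hm => by
      rw [coeff_sub, coeff_smul, smul_eq_mul]
      rcases hm.eq_or_lt with rfl | hm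
      · rw [ha, div_mul_cancel₀ _ hgt.coeff_ne_zero, sub_self]
      · rw [hf m (by omega), hgt.coeff_eq_zero _ _ hm, mul_zero, sub_zero]
    refine ⟨r, hr, ?_⟩
    have h := sub_mem hr' ((derivSpan B).smul_mem a (iterate_deriv_mem_derivSpan B N))
    rwa [← hg, sub_sub, sub_add_cancel] at h

theorem isDiffIdeal_diffSpan {R : Type*} [CommRing R] [Differential R] (S : Set R) :
    IsDiffIdeal (diffSpan S) := by
  intro f hf
  rw [diffSpan, Submodule.mem_sInf] at hf ⊢
  exact fun I hI => hI.1 f (hf I hI)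

theorem subset_diffSpan {R : Type*} [CommRing R] [Differential R] (S : Set R) :
    S ⊆ diffSpan S := by
  intro f hf
  rw [SetLike.mem_coe, diffSpan, Submodule.mem_sInf]
  exact fun I hI => hI.2 hf

theorem diffSpan_le {R : Type*} [CommRing R] [Differential R] {S : Set R} {I : Ideal R}
    (hI : IsDiffIdeal I) (hS : S ⊆ I) : diffSpan S ≤ I :=
  sInf_le ⟨hI, hS⟩

/-- By the Leibniz rule, the ordinary ideal generated by all derivatives of `f` is already
differential. -/
theorem diffSpan_singleton_le_span {R : Type*} [CommRing R] [Differential R] (f : R) :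
    diffSpan {f} ≤ Ideal.span (Set.range fun m : ℕ =>
      (Differential.deriv : Derivation ℤ R R)^[m] f) := by
  refine diffSpan_le (fun g hg => ?_)
    (Set.singleton_subset_iff.2 (Submodule.subset_span ⟨0, rfl⟩))
  refine Submodule.span_induction ?_ ?_ ?_ ?_ hg
  · rintro _ ⟨m, rfl⟩
    exact Submodule.subset_span ⟨m + 1, Function.iterate_succ_apply' _ _ _⟩
  · rw [map_zero]; exact zero_mem _
  · intro x y _ _ hx hy
    rw [map_add]; exact add_mem hx hy
  · intro a x hx' hx
    rw [smul_eq_mul, Derivation.leibniz, smul_eq_mul, smul_eq_mul, mul_comm x]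
    exact add_mem (Ideal.mul_mem_left _ _ hx) (Ideal.mul_mem_left _ _ hx')

/-- The linear elements of `[B]`, for `B` linear and nonconstant, are the linear combinations of
the derivatives of `B`. -/
theorem IsLinearWithTop.mem_derivSpan_of_mem_diffSpan {B f : DiffPoly F σ} {j : σ} {n : ℕ}
    (hB : IsLinearWithTop B j n) (hf : f.IsLinear) (h : f ∈ diffSpan {B}) : f ∈ derivSpan B := by
  classical
  have hred : ∀ v : σ × ℕ, ∃ r ∈ freeOf F j n, r - X v ∈ derivSpan B := fun v =>
    hB.exists_sub_mem (v.2 + 1) (X v) fun m hm => by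
      rw [coeff_X, if_neg]
      rw [Finsupp.single_left_inj one_ne_zero]
      rintro rfl
      simp only at hm
      omega
  -- Substituting for each variable its remainder modulo `B` gives an `F`-algebra endomorphism that
  -- computes remainders of linear polynomials.
  choose r hr hr' using hred
  have key : ∀ g : DiffPoly F σ, g.IsLinear → aeval r g ∈ freeOf F j n ∧
      aeval r g - g ∈ derivSpan B := by
    intro g hg
    refine hg.induction (p := fun g => aeval r g ∈ freeOf F j n ∧ aeval r g - g ∈ derivSpan B)
      (fun a => ?_) (fun a v => ?_) fun f g hf hg => ?_
    · rw [aeval_C, algebraMap_eq, sub_self]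
      refine ⟨fun m _ => ?_, zero_mem _⟩
      simp [coeff_C, eq_comm (a := (0 : σ × ℕ →₀ ℕ))]
    · rw [map_mul, aeval_C, aeval_X, algebraMap_eq, ← mul_sub, ← smul_eq_C_mul, ← smul_eq_C_mul]
      exact ⟨Submodule.smul_mem _ _ (hr v), Submodule.smul_mem _ _ (hr' v)⟩
    · rw [map_add, add_sub_add_comm]
      exact ⟨add_mem hf.1 hg.1, add_mem hf.2 hg.2⟩
  -- The image of `δ^m B` is both reduced and in `derivSpan B`, hence zero. A linear `f` in `[B]`
  -- therefore has remainder `0`.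
  have hker : diffSpan {B} ≤ RingHom.ker (aeval r : DiffPoly F σ →ₐ[F] DiffPoly F σ) := by
    refine (diffSpan_singleton_le_span B).trans (Ideal.span_le.2 ?_)
    rintro _ ⟨m, rfl⟩
    obtain ⟨h1, h2⟩ := key _ (hB.iterate_deriv m).isLinear
    have h3 := add_mem h2 (iterate_deriv_mem_derivSpan B m)
    rw [sub_add_cancel] at h3
    exact RingHom.mem_ker.2 (hB.eq_zero_of_mem h3 h1)
  have h0 : aeval r f = 0 := RingHom.mem_ker.1 (hker h)
  have h1 := (key f hf).2
  rwa [h0, zero_sub, neg_mem_iff] at h1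

/-- Initial and separant both equal the nonzero constant coefficient of the leader, so saturating by
them adds nothing. -/
theorem IsLinear.mem_diffSpan_of_mem_sat {R : Ranking σ} {A f : DiffPoly F σ} (hA : A.IsLinear)
    (hf : f ∈ sat R A) : f ∈ diffSpan {A} := by
  obtain ⟨v, hv, m, hm⟩ := hf
  have hc := hA.mem_vars_iff.1 hv.1
  rw [hA.separant_eq, hA.initial_eq hv.1] at hm
  have hu : IsUnit (((C (coeff (Finsupp.single v 1) A) : DiffPoly F σ) *
      C (coeff (Finsupp.single v 1) A)) ^ m) :=
    ((hc.isUnit.map C).mul (hc.isUnit.map C)).pow m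
  exact (Ideal.unit_mul_mem_iff_mem _ hu).1 hm

/-- If `A` is linear and unirational, and `A` is a nonzero combination of the derivatives of `B`,
then some `B - c` with `c ∈ F` lies in `[A]`. -/
theorem exists_sub_C_mem_diffSpan {E : Type*} [CharZero F] [Field E] [Differential E] [Algebra F E]
    [DifferentialAlgebra F E] {R : Ranking (Fin 2)} {A B : DiffPoly F (Fin 2)}
    (hA : A.IsLinear) (hA0 : A ≠ 0) (hB : B.IsLinear) (hAB : A ∈ derivSpan B)
    (h : IsUnirational E R A) : ∃ c : F, B - C c ∈ diffSpan {A} := by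
  obtain ⟨u, P, Q, hu, hPQ, hgen⟩ := h
  set η : Fin 2 → E :=
    fun i => diffEval (fun _ => u) (P i) / diffEval (fun _ => u) (Q i) with hη
  have hmem : ∀ f, f ∈ sat R A ↔ diffEval η f = 0 := fun f => by
    rw [← hgen]; rfl
  -- Membership of `0` in `sat R A` supplies a leader of `A`; with it `A` lies in `sat R A` with
  -- exponent `0`.
  obtain ⟨v, hv, -⟩ := (hmem 0).2 (map_zero _)
  have hAη : diffEval η A = 0 :=
    (hmem A).1 ⟨v, hv, 0, by simpa using subset_diffSpan {A} rfl⟩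
  obtain ⟨M, c, hc, hAc⟩ := exists_sum_of_mem_derivSpan hAB hA0
  have hfrac : ∀ i, IsDiffFraction F u (η i) := fun i => ⟨P i, Q i, (hPQ i).1, rfl⟩
  have hBfrac : IsDiffFraction F u (diffEval η B) := by
    refine hB.induction (p := fun B => IsDiffFraction F u (diffEval η B))
      (fun a => ?_) (fun a v => ?_) fun f g hf hg => ?_
    · rw [diffEval_C]; exact .algebraMap u a
    · rw [map_mul, diffEval_C, diffEval_X]
      exact ((hfrac v.1).iterate_deriv v.2).algebraMap_mul a
    · rw [map_add]; exact hf.add hu hg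
  obtain ⟨P', Q', hQ', hw⟩ := hBfrac
  rw [hAc, map_sum] at hAη
  simp only [map_mul, diffEval_C, diffEval_iterate_deriv] at hAη
  obtain ⟨b, hb⟩ := mem_range_algebraMap_of_sum_iterate_deriv_eq_zero hu hQ' hw hc hAη
  refine ⟨b, hA.mem_diffSpan_of_mem_sat ((hmem _).2 ?_)⟩
  rw [map_sub, diffEval_C, hb, sub_self]

theorem not_isUnirational_of_ord_lt {E : Type*} [CharZero F] [Field E] [Differential E]
    [Algebra F E] [DifferentialAlgebra F E] {R : Ranking (Fin 2)} {A B : DiffPoly F (Fin 2)}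
    (hA : A.IsLinear) (hA' : A ∉ Set.range C) (hB : B.IsLinear) (hB' : B ∉ Set.range C)
    (hAB : A ∈ diffSpan {B}) (hord : B.ord < A.ord) : ¬ IsUnirational E R A := by
  intro h
  obtain ⟨j, n, htop⟩ := hA.exists_isLinearWithTop hA'
  obtain ⟨i, m, htopB⟩ := hB.exists_isLinearWithTop hB'
  rw [htop.ord_eq, htopB.ord_eq] at hord
  have hmn : m < n := by exact_mod_cast hord
  have hA0 : A ≠ 0 := by rintro rfl; exact hA' ⟨0, C_0⟩
  obtain ⟨c, hc⟩ := exists_sub_C_mem_diffSpan hA hA0 hB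
    (htopB.mem_derivSpan_of_mem_diffSpan hA hAB) h
  have h1 := htop.mem_derivSpan_of_mem_diffSpan (hB.sub (isLinear_C c)) hc
  refine hB' ⟨c, (sub_eq_zero.1 (htop.eq_zero_of_mem h1 fun k hk => ?_)).symm⟩
  rw [coeff_sub, htopB.coeff_eq_zero _ _ (by omega)]
  simp [coeff_C, eq_comm (a := (0 : Fin 2 × ℕ →₀ ℕ))]

/-- Subtracting from `A` the multiple of `B` with the same coefficient at the top derivative of `B`
leaves a reduced element of `derivSpan B`, which is zero. So `A = a • B`, and `a ≠ 0` because `A` is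
nonconstant. -/
theorem diffSpan_eq_of_ord_le [Fintype σ] {A B : DiffPoly F σ}
    (hA : A.IsLinear) (hA' : A ∉ Set.range C) (hB : B.IsLinear) (hB' : B ∉ Set.range C)
    (hAB : diffSpan {A} ≤ diffSpan {B}) (hord : A.ord ≤ B.ord) :
    diffSpan {A} = diffSpan {B} := by
  obtain ⟨i, m, htopA⟩ := hA.exists_isLinearWithTop hA'
  obtain ⟨j, n, htop⟩ := hB.exists_isLinearWithTop hB'
  rw [htop.ord_eq, htopA.ord_eq] at hord
  have hmn : m ≤ n := by exact_mod_cast hord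
  have hmem := htop.mem_derivSpan_of_mem_diffSpan hA (hAB (subset_diffSpan {A} rfl))
  set a := coeff (Finsupp.single (j, n) 1) A / coeff (Finsupp.single (j, n) 1) B with ha
  have hAaB : A = a • B := by
    refine sub_eq_zero.1 (htop.eq_zero_of_mem (sub_mem hmem
      (Submodule.smul_mem _ a (iterate_deriv_mem_derivSpan B 0))) fun k hk => ?_)
    rw [coeff_sub, coeff_smul, smul_eq_mul]
    rcases hk.eq_or_lt with rfl | hk
    · rw [ha, div_mul_cancel₀ _ htop.coeff_ne_zero, sub_self]
    · rw [htopA.coeff_eq_zero _ _ (by omega), htop.coeff_eq_zero _ _ hk, mul_zero, sub_zero]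
  have ha0 : a ≠ 0 := by
    intro h0
    rw [h0, zero_smul] at hAaB
    exact hA' ⟨0, by rw [hAaB, C_0]⟩
  refine le_antisymm hAB (diffSpan_le (isDiffIdeal_diffSpan _) (Set.singleton_subset_iff.2 ?_))
  have hBA : B = C a⁻¹ * A := by rw [hAaB, ← smul_eq_C_mul, smul_smul, inv_mul_cancel₀ ha0, one_smul]
  rw [SetLike.mem_coe, hBA]
  exact Ideal.mul_mem_left _ _ (subset_diffSpan {A} rfl)

end Linear

end DiffPoly

theorem mainTheorem10 {F : Type*} {E : Type*} [Field F] [CharZero F] [Differential F] [Field E]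
    [Differential E] [Algebra F E] [DifferentialAlgebra F E] (hE : IsUniversalDiffExt F E)
    (R : Ranking (Fin 2)) (A B : DiffPoly F (Fin 2))
    (hA : A.IsLinear) (hA' : A ∉ Set.range MvPolynomial.C)
    (hB : B.IsLinear) (hB' : B ∉ Set.range MvPolynomial.C) :
    (A ∈ diffSpan {B} → B.ord < A.ord → ¬ IsUnirational E R A) ∧
    (IsUnirational E R A → diffSpan {A} ≤ diffSpan {B} → diffSpan {A} = diffSpan {B}) := by
  refine ⟨DiffPoly.not_isUnirational_of_ord_lt hA hA' hB hB', fun h hAB => ?_⟩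
  refine DiffPoly.diffSpan_eq_of_ord_le hA hA' hB hB' hAB (not_lt.1 fun hlt => ?_)
  exact DiffPoly.not_isUnirational_of_ord_lt hA hA' hB hB'
    (hAB (DiffPoly.subset_diffSpan {A} rfl)) hlt h
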